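/- Let $A_0=\begin{pmatrix}1&0\\1&1\end{pmatrix}$ and $A_1=\begin{pmatrix}1&1\\0&1\end{pmatrix}$. For real $\alpha>0$, real $\beta$ and $N\in\mathbb N$, define the Diophantine partition function $$Z_N(\alpha;\beta)=\sum_{\sigma\in\{0,1\}^N}\frac{1}{\bigl|\operatorname{Tr}\bigl(M_\alpha\,(A_{\sigma_1}A_{\sigma_2}\cdots A_{\sigma_N})^{T}\bigr)\bigr|^{\beta}},\qquad M_\alpha=\begin{pmatrix}0&-1\\0&\alpha\end{pmatrix};$$ that is, $Z_N(\alpha;\beta)=\sum_\sigma |\alpha q_\sigma-p_\sigma|^{-\beta}$, where $\binom{p_\sigma}{q_\sigma}$ is the right column of $A_{\sigma_1}\cdots A_{\sigma_N}$. Theorem. The number $e$ has a $\sqrt N\log N$-free energy limit for $\beta>2$, and so does $e-1$: for $\alpha=e$ and for $\alpha=e-1$, and for every real $\beta>2$, the limit $$\lim_{N\to\infty}\frac{\log Z_N(\alpha;\beta)}{\sqrt N\,\log N}$$ exists (as a finite real number). -/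

import Mathlib

open Filter Topology

namespace FareyEnergy

noncomputable section

/-- The Hilbert-Schmidt product `A * B = Tr (A Bᵀ) = ∑ i j, A i j * B i j` of two square
matrices. -/
def hsProd {n : ℕ} (A B : Matrix (Fin n) (Fin n) ℝ) : ℝ :=
  Matrix.trace (A * B.transpose)

/-- The ordered product `A_{σ 0} A_{σ 1} ⋯ A_{σ (N-1)}` attached to a state `σ`. -/
def stateProd {n k : ℕ} (A : Fin k → Matrix (Fin n) (Fin n) ℝ) {N : ℕ} (σ : Fin N → Fin k) :
    Matrix (Fin n) (Fin n) ℝ :=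
  (List.ofFn fun i => A (σ i)).prod

/-- The partition function of the `n × n` matrix `M` and the tuple `A` of `n × n` matrices:
the sum of `1 / |M * (A_{σ 0} ⋯ A_{σ (N-1)})| ^ β` over all `k ^ N` states `σ`. -/
def matrixPartition {n k : ℕ} (A : Fin k → Matrix (Fin n) (Fin n) ℝ)
    (M : Matrix (Fin n) (Fin n) ℝ) (N : ℕ) (β : ℝ) : ℝ :=
  ∑ σ : Fin N → Fin k, 1 / |hsProd M (stateProd A σ)| ^ β

/-- The two Farey matrices `A₀` and `A₁`. -/
def fareyMatrix : Fin 2 → Matrix (Fin 2) (Fin 2) ℝ :=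
  ![!![1, 0; 1, 1], !![1, 1; 0, 1]]

/-- The Diophantine partition function `Z_N(α; β)`. If the right column of the product of a state
is `(p, q)`, the term of that state is `1 / |α q - p| ^ β`. -/
def diophantineZ (α : ℝ) (N : ℕ) (β : ℝ) : ℝ :=
  matrixPartition fareyMatrix !![0, -1; 0, α] N β

/-- `α` has an `f(N)`-free energy limit for `β > βc`: for every real `β > βc` the sequence
`log Z_N(α; β) / f(N)` converges to a (finite) real number. -/
def HasFreeEnergyLimitAbove (α : ℝ) (f : ℕ → ℝ) (βc : ℝ) : Prop :=
  ∀ β : ℝ, βc < β →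
    ∃ l : ℝ, Tendsto (fun N : ℕ => Real.log (diophantineZ α N β) / f N) atTop (𝓝 l)

end

end FareyEnergy

/-! The Farey matrices send a row (s, t) to (s + t, t) and (s, s + t), so Z_N sums |second
entry|^(-β) over the leaves of a binary tree rooted at (-1, α). While the signs are mixed and the
entries distinct in size, exactly one child has mixed signs again: it is the next pair of the
subtractive Euclidean algorithm, up to sign. The sibling has entries of equal sign, and for β > 2
its whole subtree contributes at most a constant times m^(-β), uniformly in depth, when the entries
have size at least m (`superharmonic`, `rowPartition_le`). Up to a factor linear in N, which the
logarithm makes negligible, Z_N is thus governed by the Euclidean remainders at time N.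

For e these remainders are the integrals of Hermite and Cohn, whose recurrences encode the partial
quotients 1, 1, 2n + 2 (`euclidStep_iterate_cohn_succ`). Stage k is reached at time k² + 3k, plus
one step for e itself, and has size 1/k! up to exponential factors. With k ~ √N, log Z_N ~ β k log k
~ (β/2) √N log N. -/

namespace FareyEnergy

/-! ### The partition function as a recursion on rows -/

/-- The partition function of the row vector `(s, t)`: the sum of `1 / |w| ^ β` over the second
entries `w` of all products `(s, t) A_{σ 0} ⋯ A_{σ (N-1)}`. -/
noncomputable def rowPartition (β : ℝ) : ℕ → ℝ → ℝ → ℝ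
  | 0, _, t => 1 / |t| ^ β
  | N + 1, s, t => rowPartition β N (s + t) t + rowPartition β N s (s + t)

theorem hsProd_mul {n : ℕ} (M A R : Matrix (Fin n) (Fin n) ℝ) :
    hsProd M (A * R) = hsProd (A.transpose * M) R := by
  unfold hsProd
  rw [Matrix.transpose_mul, ← Matrix.mul_assoc, Matrix.trace_mul_comm, Matrix.mul_assoc]

theorem matrixPartition_succ {n k : ℕ} (A : Fin k → Matrix (Fin n) (Fin n) ℝ)
    (M : Matrix (Fin n) (Fin n) ℝ) (N : ℕ) (β : ℝ) :
    matrixPartition A M (N + 1) β =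
      ∑ i, matrixPartition A ((A i).transpose * M) N β := by
  unfold matrixPartition
  rw [← (Fin.consEquiv fun _ : Fin (N + 1) => Fin k).sum_comp, Fintype.sum_prod_type]
  refine Finset.sum_congr rfl fun i _ => Finset.sum_congr rfl fun σ _ => ?_
  have h : stateProd A (Fin.consEquiv (fun _ : Fin (N + 1) => Fin k) (i, σ)) =
      A i * stateProd A σ := by
    simp [stateProd, List.ofFn_succ, Fin.consEquiv]
  rw [h, hsProd_mul]

theorem matrixPartition_fareyMatrix (β : ℝ) (N : ℕ) (s t : ℝ) :
    matrixPartition fareyMatrix !![0, s; 0, t] N β = rowPartition β N s t := by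
  induction N generalizing s t with
  | zero => simp [matrixPartition, rowPartition, hsProd, stateProd, Matrix.trace_fin_two]
  | succ N ih =>
    have h0 : (fareyMatrix 0).transpose * !![0, s; 0, t] = !![0, s + t; 0, t] := by
      ext i j; fin_cases i <;> fin_cases j <;> simp [fareyMatrix, Matrix.mul_apply]
    have h1 : (fareyMatrix 1).transpose * !![0, s; 0, t] = !![0, s; 0, s + t] := by
      ext i j; fin_cases i <;> fin_cases j <;> simp [fareyMatrix, Matrix.mul_apply]
    rw [matrixPartition_succ, Fin.sum_univ_two, h0, h1, ih, ih, rowPartition]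

theorem diophantineZ_eq (α : ℝ) (N : ℕ) (β : ℝ) :
    diophantineZ α N β = rowPartition β N (-1) α :=
  matrixPartition_fareyMatrix β N (-1) α

theorem rowPartition_nonneg (β : ℝ) (N : ℕ) (s t : ℝ) : 0 ≤ rowPartition β N s t := by
  induction N generalizing s t with
  | zero => unfold rowPartition; positivity
  | succ N ih => exact add_nonneg (ih _ _) (ih _ _)

theorem rowPartition_neg (β : ℝ) (N : ℕ) (s t : ℝ) :
    rowPartition β N (-s) (-t) = rowPartition β N s t := by
  induction N generalizing s t with
  | zero => simp [rowPartition]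
  | succ N ih =>
    rw [rowPartition, rowPartition, ← neg_add, ih, ih]

/-- The state that uses only A₀ leaves the second entry unchanged. -/
theorem le_rowPartition (β : ℝ) (N : ℕ) (s t : ℝ) : 1 / |t| ^ β ≤ rowPartition β N s t := by
  induction N generalizing s t with
  | zero => exact le_rfl
  | succ N ih => exact (ih (s + t) t).trans (le_add_of_nonneg_right (rowPartition_nonneg ..))

/-! ### Rows with entries of equal sign -/

/-- The chord bound for the convex function `u ↦ (1 + u) ^ (-γ)` on `[0, 1]`. -/
theorem one_add_rpow_neg_le {γ u : ℝ} (hγ : 0 < γ) (h0 : 0 ≤ u) (h1 : u ≤ 1) :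
    (1 + u) ^ (-γ) ≤ 1 - (1 - 2 ^ (-γ)) * u := by
  -- Bernoulli twice: for 2^u, and for (2^(-γ))^u, which dominates (1 + u)^(-γ).
  have h2 : (2 : ℝ) ^ u ≤ 1 + u := by
    have := rpow_one_add_le_one_add_mul_self (s := 1) (by norm_num) h0 h1
    rwa [one_add_one_eq_two, mul_one] at this
  have h3 := rpow_one_add_le_one_add_mul_self (s := (2 : ℝ) ^ (-γ) - 1)
    (by linarith [Real.rpow_pos_of_pos two_pos (-γ)]) h0 h1
  rw [add_sub_cancel, ← Real.rpow_mul two_pos.le, mul_comm, Real.rpow_mul two_pos.le] at h3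
  have h4 := Real.rpow_le_rpow_of_nonpos (by positivity) h2 (neg_nonpos.2 hγ.le)
  linarith

/-- Strict superharmonicity of `(s + t) ^ (-γ) / (s t)` under the Farey steps. -/
theorem superharmonic {γ s t : ℝ} (hγ : 0 < γ) (hs : 0 < s) (ht : 0 < t) :
    ((s + t) + t) ^ (-γ) / ((s + t) * t) + (s + (s + t)) ^ (-γ) / (s * (s + t)) +
        2 * (1 - 2 ^ (-γ)) * ((s + t) ^ (-γ) / (s + t) ^ 2) ≤
      (s + t) ^ (-γ) / (s * t) := by
  have hr : 0 < s + t := add_pos hs ht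
  have key : ∀ u, 0 < u → u ≤ s + t →
      ((s + t) + u) ^ (-γ) ≤ (s + t) ^ (-γ) * (1 - (1 - 2 ^ (-γ)) * (u / (s + t))) := by
    intro u hu hle
    have e : (s + t) + u = (s + t) * (1 + u / (s + t)) := by field_simp
    rw [e, Real.mul_rpow hr.le (by positivity)]
    exact mul_le_mul_of_nonneg_left
      (one_add_rpow_neg_le hγ (by positivity) ((div_le_one hr).2 hle)) (by positivity)
  have k1 := key t ht (by linarith)
  have k2 := key s hs (by linarith)
  rw [add_comm s (s + t)]
  -- Without the power, 1/(st) is exactly harmonic; the linear term of the chord bound gains the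
  -- same multiple of 1/(s + t)² from each child.
  calc _ ≤ (s + t) ^ (-γ) * (1 - (1 - 2 ^ (-γ)) * (t / (s + t))) / ((s + t) * t) +
        (s + t) ^ (-γ) * (1 - (1 - 2 ^ (-γ)) * (s / (s + t))) / (s * (s + t)) +
        2 * (1 - 2 ^ (-γ)) * ((s + t) ^ (-γ) / (s + t) ^ 2) := by gcongr
    _ = _ := by field_simp; ring

theorem one_sub_two_rpow_pos {β : ℝ} (hβ : 2 < β) : (0 : ℝ) < 1 - 2 ^ (-(β - 2)) :=
  sub_pos.2 (Real.rpow_lt_one_of_one_lt_of_neg one_lt_two (by linarith))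

theorem rpow_neg_split {r : ℝ} (hr : 0 < r) (β : ℝ) :
    r ^ (-(β - 2)) / r ^ 2 = 1 / r ^ β := by
  rw [one_div, ← Real.rpow_neg hr.le, ← Real.rpow_natCast, ← Real.rpow_sub hr]
  congr 1; push_cast; ring

/-- For γ = β - 2 the superharmonic gain is a multiple of (s + t)^(-β), the leading term of the
second child, so the induction closes uniformly in N. -/
theorem rowPartition_le_of_pos {β : ℝ} (hβ : 2 < β) (N : ℕ) {s t : ℝ} (hs : 0 < s) (ht : 0 < t) :
    rowPartition β N s t ≤
      1 / t ^ β + (s + t) ^ (-(β - 2)) / (s * t) / (2 * (1 - 2 ^ (-(β - 2)))) := by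
  have hc := one_sub_two_rpow_pos hβ
  induction N generalizing s t with
  | zero =>
    rw [rowPartition, abs_of_pos ht]
    exact le_add_of_nonneg_right (by positivity)
  | succ N ih =>
    have hr : 0 < s + t := add_pos hs ht
    have h := superharmonic (sub_pos.2 hβ) hs ht
    rw [rpow_neg_split hr] at h
    have h' := div_le_div_of_nonneg_right h (mul_pos two_pos hc).le
    rw [add_div, add_div, mul_div_cancel_left₀ _ (mul_pos two_pos hc).ne'] at h'
    rw [rowPartition]
    linarith [ih hr ht, ih hs hr]

/-- The constant in the bound for rows whose entries have equal signs. -/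
noncomputable def rowConst (β : ℝ) : ℝ := 1 + 1 / (2 * (1 - 2 ^ (-(β - 2))))

theorem one_le_rowConst {β : ℝ} (hβ : 2 < β) : 1 ≤ rowConst β := by
  have hc := one_sub_two_rpow_pos hβ
  unfold rowConst
  exact le_add_of_nonneg_right (by positivity)

theorem rowPartition_le {β : ℝ} (hβ : 2 < β) (N : ℕ) {m s t : ℝ} (hm : 0 < m) (hs : m ≤ s)
    (ht : m ≤ t) : rowPartition β N s t ≤ rowConst β / m ^ β := by
  have hc := one_sub_two_rpow_pos hβ
  refine (rowPartition_le_of_pos hβ N (hm.trans_le hs) (hm.trans_le ht)).trans ?_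
  have hs0 := hm.trans_le hs
  have h1 : 1 / t ^ β ≤ 1 / m ^ β := by gcongr
  have h2 : (s + t) ^ (-(β - 2)) / (s * t) ≤ 1 / m ^ β := by
    rw [← rpow_neg_split hm, sq]
    have : (s + t) ^ (-(β - 2)) ≤ m ^ (-(β - 2)) :=
      Real.rpow_le_rpow_of_nonpos hm (by linarith) (by linarith)
    gcongr
  calc _ ≤ 1 / m ^ β + 1 / m ^ β / (2 * (1 - 2 ^ (-(β - 2)))) := by gcongr
    _ = _ := by unfold rowConst; ring

/-! ### The mixed-sign path and the Euclidean algorithm -/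

/-- A step of the subtractive Euclidean algorithm. -/
noncomputable def euclidStep (p : ℝ × ℝ) : ℝ × ℝ :=
  if p.1 < p.2 then (p.1, p.2 - p.1) else (p.1 - p.2, p.2)

theorem euclidStep_of_lt {x y : ℝ} (h : x < y) : euclidStep (x, y) = (x, y - x) := if_pos h

theorem euclidStep_of_le {x y : ℝ} (h : y ≤ x) : euclidStep (x, y) = (x - y, y) :=
  if_neg h.not_gt

theorem euclidStep_nonneg {p : ℝ × ℝ} (hp : 0 ≤ p) : 0 ≤ euclidStep p := by
  obtain ⟨x, y⟩ := p
  obtain ⟨hx, hy⟩ := Prod.mk_le_mk.1 hp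
  rcases lt_or_ge x y with h | h
  · rw [euclidStep_of_lt h]; exact Prod.mk_le_mk.2 ⟨hx, sub_nonneg.2 h.le⟩
  · rw [euclidStep_of_le h]; exact Prod.mk_le_mk.2 ⟨sub_nonneg.2 h, hy⟩

theorem euclidStep_le {p : ℝ × ℝ} (hp : 0 ≤ p) : euclidStep p ≤ p := by
  obtain ⟨x, y⟩ := p
  obtain ⟨hx, hy⟩ := Prod.mk_le_mk.1 hp
  rcases lt_or_ge x y with h | h
  · rw [euclidStep_of_lt h]; exact Prod.mk_le_mk.2 ⟨le_rfl, sub_le_self _ hx⟩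
  · rw [euclidStep_of_le h]; exact Prod.mk_le_mk.2 ⟨sub_le_self _ hy, le_rfl⟩

theorem euclidStep_iterate_nonneg {p : ℝ × ℝ} (hp : 0 ≤ p) (n : ℕ) : 0 ≤ euclidStep^[n] p := by
  induction n with
  | zero => exact hp
  | succ n ih => rw [Function.iterate_succ_apply']; exact euclidStep_nonneg ih

theorem euclidStep_iterate_antitone {p : ℝ × ℝ} (hp : 0 ≤ p) :
    Antitone fun n => euclidStep^[n] p :=
  antitone_nat_of_succ_le fun n => by
    rw [Function.iterate_succ_apply']
    exact euclidStep_le (euclidStep_iterate_nonneg hp n)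

theorem rowPartition_euclidStep_le (β : ℝ) (N : ℕ) (p : ℝ × ℝ) :
    rowPartition β N (-(euclidStep p).1) (euclidStep p).2 ≤ rowPartition β (N + 1) (-p.1) p.2 := by
  obtain ⟨x, y⟩ := p
  rw [rowPartition]
  rcases lt_or_ge x y with h | h
  · rw [euclidStep_of_lt h, sub_eq_neg_add]
    exact le_add_of_nonneg_left (rowPartition_nonneg ..)
  · rw [euclidStep_of_le h, neg_sub, sub_eq_neg_add]
    exact le_add_of_nonneg_right (rowPartition_nonneg ..)

theorem rowPartition_iterate_le (β : ℝ) (N n : ℕ) (p : ℝ × ℝ) :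
    rowPartition β N (-(euclidStep^[n] p).1) (euclidStep^[n] p).2 ≤
      rowPartition β (N + n) (-p.1) p.2 := by
  induction n generalizing p with
  | zero => exact le_rfl
  | succ n ih =>
    exact (ih (euclidStep p)).trans (rowPartition_euclidStep_le β (N + n) p)

/-- One child continues the Euclidean path; the added term pays for the equal-sign sibling. -/
theorem rowPartition_succ_le {β : ℝ} (hβ : 2 < β) (N : ℕ) {m : ℝ} (hm : 0 < m) {p : ℝ × ℝ}
    (hp : 0 ≤ p) (h1 : m ≤ (euclidStep p).1) (h2 : m ≤ (euclidStep p).2) :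
    rowPartition β (N + 1) (-p.1) p.2 ≤
      rowPartition β N (-(euclidStep p).1) (euclidStep p).2 + rowConst β / m ^ β := by
  obtain ⟨x, y⟩ := p
  obtain ⟨hx, hy⟩ := Prod.mk_le_mk.1 hp
  rw [rowPartition]
  rcases lt_or_ge x y with h | h
  · rw [euclidStep_of_lt h] at h1 h2 ⊢
    rw [← sub_eq_neg_add, add_comm]
    gcongr
    exact rowPartition_le hβ N hm h2 (by simp only at h2; linarith)
  · rw [euclidStep_of_le h] at h1 h2 ⊢
    rw [neg_sub, ← sub_eq_neg_add]
    gcongr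
    -- Here both entries of the sibling are negative.
    rw [← neg_sub x y, rowPartition_neg]
    exact rowPartition_le hβ N hm (by simp only at h1; linarith) h1

theorem rowPartition_le_of_iterate {β : ℝ} (hβ : 2 < β) (N : ℕ) {m : ℝ} (hm : 0 < m) {p : ℝ × ℝ}
    (hp : 0 ≤ p) (h : (m, m) ≤ euclidStep^[N] p) :
    rowPartition β N (-p.1) p.2 ≤ (N * rowConst β + 1) / m ^ β := by
  induction N generalizing p with
  | zero =>
    have hy : m ≤ p.2 := h.2
    rw [rowPartition, abs_of_pos (hm.trans_le hy), Nat.cast_zero, zero_mul, zero_add]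
    gcongr
  | succ N ih =>
    -- Remainders never increase, so the lower bound at time N holds at every earlier step.
    have hE : (m, m) ≤ euclidStep p :=
      h.trans (euclidStep_iterate_antitone hp (Nat.succ_le_succ N.zero_le))
    have h3 := ih (euclidStep_nonneg hp) h
    have h4 := rowPartition_succ_le hβ N hm hp hE.1 hE.2
    calc _ ≤ _ := h4
      _ ≤ (N * rowConst β + 1) / m ^ β + rowConst β / m ^ β := by gcongr
      _ = _ := by push_cast; ring

/-! ### Cohn's integrals: recurrences and size -/

/-- The integral of `x ^ i (1 - x) ^ j eˣ` over the unit interval. -/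
noncomputable def expBeta (i j : ℕ) : ℝ := ∫ x in (0 : ℝ)..1, x ^ i * (1 - x) ^ j * Real.exp x

theorem expBeta_pos (i j : ℕ) : 0 < expBeta i j := by
  refine intervalIntegral.intervalIntegral_pos_of_pos_on
    (Continuous.intervalIntegrable (by fun_prop) _ _) (fun x hx => ?_) one_pos
  have h0 : 0 < x := hx.1
  have h1 : 0 < 1 - x := sub_pos.2 hx.2
  positivity

theorem expBeta_add (i j : ℕ) : expBeta (i + 1) j + expBeta i (j + 1) = expBeta i j := by
  unfold expBeta
  rw [← intervalIntegral.integral_add (Continuous.intervalIntegrable (by fun_prop) _ _)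
    (Continuous.intervalIntegrable (by fun_prop) _ _)]
  congr 1; ext x; ring

/-- The derivative of x^(i+1) (1 - x)^(j+1) eˣ integrates to zero, as that function vanishes at both
endpoints. -/
theorem expBeta_by_parts (i j : ℕ) :
    (i + 1) * expBeta i (j + 1) + expBeta (i + 1) (j + 1) = (j + 1) * expBeta (i + 1) j := by
  have hd : ∀ x : ℝ, HasDerivAt (fun x : ℝ => x ^ (i + 1) * (1 - x) ^ (j + 1) * Real.exp x)
      ((i + 1) * (x ^ i * (1 - x) ^ (j + 1) * Real.exp x) +
        x ^ (i + 1) * (1 - x) ^ (j + 1) * Real.exp x -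
        (j + 1) * (x ^ (i + 1) * (1 - x) ^ j * Real.exp x)) x := by
    intro x
    have h := (((hasDerivAt_id x).pow (i + 1)).mul
      (((hasDerivAt_id x).const_sub 1).pow (j + 1))).mul (Real.hasDerivAt_exp x)
    refine h.congr_deriv ?_
    simp
    ring
  have h := intervalIntegral.integral_eq_sub_of_hasDerivAt (a := 0) (b := 1) (fun x _ => hd x)
    (Continuous.intervalIntegrable (by fun_prop) _ _)
  rw [intervalIntegral.integral_sub (Continuous.intervalIntegrable (by fun_prop) _ _)
      (Continuous.intervalIntegrable (by fun_prop) _ _),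
    intervalIntegral.integral_add (Continuous.intervalIntegrable (by fun_prop) _ _)
      (Continuous.intervalIntegrable (by fun_prop) _ _),
    intervalIntegral.integral_const_mul, intervalIntegral.integral_const_mul] at h
  simp only [sub_self, ne_eq, Nat.succ_ne_zero, not_false_eq_true, zero_pow, mul_zero, zero_mul,
    sub_zero] at h
  unfold expBeta
  linarith

theorem expBeta_zero_zero : expBeta 0 0 = Real.exp 1 - 1 := by
  simp [expBeta]

theorem expBeta_one_zero : expBeta 1 0 = 1 := by
  have hd : ∀ x : ℝ, HasDerivAt (fun x : ℝ => (x - 1) * Real.exp x)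
      (x ^ 1 * (1 - x) ^ 0 * Real.exp x) x := fun x =>
    (((hasDerivAt_id x).sub_const 1).mul (Real.hasDerivAt_exp x)).congr_deriv (by simp; ring)
  have h := intervalIntegral.integral_eq_sub_of_hasDerivAt (a := 0) (b := 1) (fun x _ => hd x)
    (Continuous.intervalIntegrable (by fun_prop) _ _)
  simpa [expBeta] using h

/-- The integrals of Hermite and Cohn: the distances `|q e - p|` of the convergents of `e`. -/
noncomputable def cohnA (n : ℕ) : ℝ := expBeta n n / n.factorial

/-- The second of the three families of Cohn's integrals. -/
noncomputable def cohnB (n : ℕ) : ℝ := expBeta (n + 1) n / n.factorial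

/-- The third of the three families of Cohn's integrals. -/
noncomputable def cohnC (n : ℕ) : ℝ := expBeta n (n + 1) / n.factorial

theorem cohnA_pos (n : ℕ) : 0 < cohnA n := div_pos (expBeta_pos _ _) (by positivity)

theorem cohnB_pos (n : ℕ) : 0 < cohnB n := div_pos (expBeta_pos _ _) (by positivity)

theorem cohnC_pos (n : ℕ) : 0 < cohnC n := div_pos (expBeta_pos _ _) (by positivity)

theorem cohnA_eq (n : ℕ) : cohnA n = cohnB n + cohnC n := by
  unfold cohnA cohnB cohnC
  rw [← expBeta_add, add_div]

theorem cohnA_succ (n : ℕ) : cohnA (n + 1) = cohnB n - cohnC n := by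
  have h := expBeta_by_parts n n
  have hf : (n.factorial : ℝ) ≠ 0 := by positivity
  have hn : (n + 1 : ℝ) ≠ 0 := by positivity
  unfold cohnA cohnB cohnC
  rw [Nat.factorial_succ]
  push_cast
  field_simp
  linarith

theorem cohnC_eq (n : ℕ) : cohnC n = cohnB (n + 1) + 2 * (n + 1) * cohnA (n + 1) := by
  have h := expBeta_by_parts n (n + 1)
  have h1 := expBeta_add n (n + 1)
  have h2 := expBeta_add (n + 1) (n + 1)
  have hf : (n.factorial : ℝ) ≠ 0 := by positivity
  have hn : (n + 1 : ℝ) ≠ 0 := by positivity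
  unfold cohnA cohnB cohnC
  rw [Nat.factorial_succ]
  push_cast at h ⊢
  field_simp
  rw [← h1, ← h2] at *
  linarith

theorem cohnA_le (n : ℕ) : cohnA n ≤ Real.exp 1 / n.factorial := by
  induction n with
  | zero => simp [cohnA, expBeta_zero_zero]
  | succ n ih =>
    have hn : (0 : ℝ) < n + 1 := by positivity
    have h : (n + 1) * cohnA (n + 1) ≤ cohnA n := by
      have := mul_pos hn (cohnA_pos (n + 1))
      linarith [cohnA_eq n, cohnC_eq n, cohnB_pos n, cohnB_pos (n + 1)]
    rw [Nat.factorial_succ, Nat.cast_mul, Nat.cast_succ, mul_comm, ← div_div, le_div_iff₀ hn]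
    linarith

theorem le_cohnA (n : ℕ) : 1 / (8 ^ n * n.factorial) ≤ cohnA n := by
  induction n with
  | zero =>
    have := Real.add_one_le_exp 1
    simp only [cohnA, expBeta_zero_zero]
    norm_num
    linarith
  | succ n ih =>
    have hn : (0 : ℝ) < n + 1 := by positivity
    -- The recurrences give A_n = 2 B_{n+1} + (4n + 5) A_{n+1}, and B_{n+1} < A_{n+1}.
    have h : cohnA n ≤ 8 * (n + 1) * cohnA (n + 1) := by
      have h1 := mul_nonneg n.cast_nonneg (cohnA_pos (n + 1)).le
      linarith [cohnA_eq n, cohnC_eq n, cohnA_succ n, cohnC_pos (n + 1), cohnA_eq (n + 1),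
        cohnB_pos (n + 1), cohnA_pos (n + 1)]
    rw [Nat.factorial_succ, Nat.cast_mul, Nat.cast_succ, pow_succ,
      show (8 ^ n * 8 * ((n + 1) * n.factorial) : ℝ) = 8 ^ n * n.factorial * (8 * (n + 1)) by ring,
      ← div_div, div_le_iff₀ (by positivity)]
    linarith

theorem half_cohnA_le_cohnB (n : ℕ) : cohnA n / 2 ≤ cohnB n := by
  linarith [cohnA_eq n, cohnA_succ n, cohnA_pos (n + 1)]

theorem cohnB_lt_cohnA (n : ℕ) : cohnB n < cohnA n := by
  linarith [cohnA_eq n, cohnC_pos n]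

/-! ### The Euclidean path of e -/

theorem euclidStep_iterate_sub {x z : ℝ} (hx : 0 < x) (hz : 0 < z) (k : ℕ) :
    euclidStep^[k] (x, z + k * x) = (x, z) ∧ euclidStep^[k] (z + k * x, x) = (z, x) := by
  induction k with
  | zero => simp
  | succ k ih =>
    have hlt : x < z + (k + 1 : ℕ) * x := by
      have : 0 ≤ (k : ℝ) * x := by positivity
      push_cast; linarith
    have e : z + (k + 1 : ℕ) * x - x = z + k * x := by push_cast; ring
    rw [Function.iterate_succ_apply, Function.iterate_succ_apply, euclidStep_of_lt hlt,
      euclidStep_of_le hlt.le, e]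
    exact ih

/-- The partial quotients 1, 1, 2n + 2 take 2n + 4 subtractions; their number is odd, so the larger
entry changes sides. -/
theorem euclidStep_iterate_cohn_succ (n : ℕ) :
    euclidStep^[2 * n + 4] (cohnB n, cohnA n) = (cohnA (n + 1), cohnB (n + 1)) ∧
      euclidStep^[2 * n + 4] (cohnA n, cohnB n) = (cohnB (n + 1), cohnA (n + 1)) := by
  have hAB := cohnB_lt_cohnA n
  have e1 : cohnA n - cohnB n = cohnC n := by linarith [cohnA_eq n]
  have hCB : cohnC n < cohnB n := by linarith [cohnA_succ n, cohnA_pos (n + 1)]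
  have e2 : cohnB n - cohnC n = cohnA (n + 1) := (cohnA_succ n).symm
  have e3 : cohnC n = cohnB (n + 1) + (2 * n + 2 : ℕ) * cohnA (n + 1) := by
    rw [cohnC_eq]; push_cast; ring
  have h := euclidStep_iterate_sub (cohnA_pos (n + 1)) (cohnB_pos (n + 1)) (2 * n + 2)
  rw [← e3] at h
  constructor
  · rw [Function.iterate_succ_apply, Function.iterate_succ_apply, euclidStep_of_lt hAB, e1,
      euclidStep_of_le hCB.le, e2]
    exact h.1
  · rw [Function.iterate_succ_apply, Function.iterate_succ_apply, euclidStep_of_le hAB.le, e1,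
      euclidStep_of_lt hCB, e2]
    exact h.2

theorem euclidStep_iterate_cohn (k : ℕ) :
    euclidStep^[k ^ 2 + 3 * k] (cohnB 0, cohnA 0) = (cohnB k, cohnA k) ∨
      euclidStep^[k ^ 2 + 3 * k] (cohnB 0, cohnA 0) = (cohnA k, cohnB k) := by
  induction k with
  | zero => exact Or.inl rfl
  | succ k ih =>
    -- k² + 3k is the sum of 2n + 4 over n < k.
    rw [show (k + 1) ^ 2 + 3 * (k + 1) = (2 * k + 4) + (k ^ 2 + 3 * k) by ring,
      Function.iterate_add_apply]
    rcases ih with h | h <;> rw [h]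
    · exact Or.inr (euclidStep_iterate_cohn_succ k).1
    · exact Or.inl (euclidStep_iterate_cohn_succ k).2

/-! ### Bounds for Z_N and the limit -/

/-- If the Euclidean algorithm of `(1, α)` is at one of Cohn's pairs at time `T`, the partition
function is bounded below from then on. -/
theorem le_diophantineZ {α β : ℝ} (hβ : 0 < β) {k N T : ℕ}
    (hT : euclidStep^[T] (1, α) = (cohnB k, cohnA k) ∨
      euclidStep^[T] (1, α) = (cohnA k, cohnB k)) (hN : T ≤ N) :
    1 / cohnA k ^ β ≤ diophantineZ α N β := by
  obtain ⟨n, rfl⟩ := Nat.exists_eq_add_of_le' hN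
  rw [diophantineZ_eq]
  refine le_trans ?_ (rowPartition_iterate_le β n T (1, α))
  refine le_trans ?_ (le_rowPartition ..)
  rcases hT with h | h <;> rw [h]
  · rw [abs_of_pos (cohnA_pos k)]
  · rw [abs_of_pos (cohnB_pos k)]
    have := cohnB_pos k
    have := (cohnB_lt_cohnA k).le
    gcongr

theorem diophantineZ_le {α β : ℝ} (hα : 0 ≤ α) (hβ : 2 < β) {k N T : ℕ}
    (hT : euclidStep^[T] (1, α) = (cohnB k, cohnA k) ∨
      euclidStep^[T] (1, α) = (cohnA k, cohnB k)) (hN : N ≤ T) :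
    diophantineZ α N β ≤ (N * rowConst β + 1) / (cohnA k / 2) ^ β := by
  have hp : (0 : ℝ × ℝ) ≤ (1, α) := Prod.mk_le_mk.2 ⟨zero_le_one, hα⟩
  have hB := half_cohnA_le_cohnB k
  have hA : cohnA k / 2 ≤ cohnA k := by linarith [cohnA_pos k]
  rw [diophantineZ_eq]
  refine rowPartition_le_of_iterate hβ N (half_pos (cohnA_pos k)) hp
    (le_trans ?_ (euclidStep_iterate_antitone hp hN))
  rcases hT with h | h
  · exact (Prod.mk_le_mk.2 ⟨hB, hA⟩).trans h.ge
  · exact (Prod.mk_le_mk.2 ⟨hA, hB⟩).trans h.ge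

theorem log_factorial_le (n : ℕ) : Real.log n.factorial ≤ n * Real.log n := by
  rw [← Real.log_pow]
  exact Real.log_le_log (by positivity) (by exact_mod_cast Nat.factorial_le_pow n)

theorem le_log_factorial (n : ℕ) : n * Real.log n - n ≤ Real.log n.factorial := by
  rcases n.eq_zero_or_pos with rfl | hn
  · simp
  have hn' : (0 : ℝ) < n := by exact_mod_cast hn
  have h := Real.log_le_log (by positivity) (Real.pow_div_factorial_le_exp (n : ℝ) hn'.le n)
  rw [Real.log_exp, Real.log_div (by positivity) (by positivity), Real.log_pow] at h
  linarith

theorem le_neg_log_cohnA (k : ℕ) : k * Real.log k - k - 1 ≤ -Real.log (cohnA k) := by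
  have h := Real.log_le_log (cohnA_pos k) (cohnA_le k)
  rw [Real.log_div (Real.exp_ne_zero _) (by positivity), Real.log_exp] at h
  linarith [le_log_factorial k]

theorem neg_log_cohnA_le (k : ℕ) : -Real.log (cohnA k) ≤ k * Real.log k + k * Real.log 8 := by
  have h := Real.log_le_log (by positivity) (le_cohnA k)
  rw [one_div, Real.log_inv, Real.log_mul (by positivity) (by positivity), Real.log_pow] at h
  linarith [log_factorial_le k]

theorem le_log_diophantineZ {α β x : ℝ} (hβ : 2 < β) {j N : ℕ} (hj : j ≤ 1)
    (hT : ∀ k, euclidStep^[k ^ 2 + 3 * k + j] (1, α) = (cohnB k, cohnA k) ∨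
      euclidStep^[k ^ 2 + 3 * k + j] (1, α) = (cohnA k, cohnB k))
    (hx : x ^ 2 = N) (hx6 : 6 ≤ x) :
    β * (x * Real.log x) - 6 * β * x ≤ Real.log (diophantineZ α N β) := by
  -- This shift ensures k² + 3k + j ≤ (k + 2)² ≤ N, so stage k is already reached.
  obtain ⟨k, hk⟩ : ∃ k, k + 2 = N.sqrt := by
    refine ⟨N.sqrt - 2, Nat.sub_add_cancel (Nat.le_sqrt.2 ?_)⟩
    have : (2 * 2 : ℝ) ≤ N := by nlinarith
    exact_mod_cast this
  have hkN : (k + 2) ^ 2 ≤ N := by rw [hk]; exact Nat.sqrt_le' N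
  have hkx : x ≤ k + 3 := by
    have h : N < (k + 3) ^ 2 := by
      have := Nat.lt_succ_sqrt' N
      rwa [← hk] at this
    have h' : (N : ℝ) < (k + 3) ^ 2 := by exact_mod_cast h
    nlinarith
  have h := Real.log_le_log (by have := cohnA_pos k; positivity)
    (le_diophantineZ (β := β) (by linarith) (hT k) (by nlinarith : k ^ 2 + 3 * k + j ≤ N))
  rw [one_div, Real.log_inv, Real.log_rpow (cohnA_pos k)] at h
  have hlog : Real.log x - 1 ≤ Real.log k := by
    have h2 : Real.log (x / 2) ≤ Real.log k :=
      -- x ≥ 6 gives x / 2 ≤ x - 3 ≤ k.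
      Real.log_le_log (by positivity) (by linarith)
    rw [Real.log_div (by positivity) two_ne_zero] at h2
    linarith [Real.log_two_lt_d9]
  have hl : Real.log x ≤ x := (Real.log_le_sub_one_of_pos (by linarith)).trans (by linarith)
  have hl1 : 1 ≤ Real.log x := by
    rw [Real.le_log_iff_exp_le (by linarith)]
    linarith [Real.exp_one_lt_d9]
  have hk0 : (x - 3) * (Real.log x - 1) ≤ k * Real.log k := by
    have : x - 3 ≤ k := by linarith
    have := sub_nonneg.2 hl1
    gcongr
  have hkx' : (k : ℝ) + 2 ≤ x := by
    have h' : ((k : ℝ) + 2) ^ 2 ≤ N := by exact_mod_cast hkN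
    rw [← hx] at h'
    exact (sq_le_sq₀ (by positivity) (by linarith)).1 h'
  have hfin : x * Real.log x - 6 * x ≤ -Real.log (cohnA k) := by
    linarith [le_neg_log_cohnA k]
  have := mul_le_mul_of_nonneg_left hfin (by linarith : (0 : ℝ) ≤ β)
  linarith

theorem log_diophantineZ_le {α β x : ℝ} (hα : 0 ≤ α) (hβ : 2 < β) {j N : ℕ} (hj : j ≤ 1)
    (hT : ∀ k, euclidStep^[k ^ 2 + 3 * k + j] (1, α) = (cohnB k, cohnA k) ∨
      euclidStep^[k ^ 2 + 3 * k + j] (1, α) = (cohnA k, cohnB k))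
    (hx : x ^ 2 = N) (hx6 : 6 ≤ x) :
    Real.log (diophantineZ α N β) ≤
      β * (x * Real.log x) + (10 * β + rowConst β + 2) * x := by
  set k := N.sqrt with hk
  have hkN : N < (k + 1) ^ 2 := Nat.lt_succ_sqrt' N
  have hkx : (k : ℝ) ≤ x := by
    have h : (k : ℝ) ^ 2 ≤ N := by exact_mod_cast Nat.sqrt_le' N
    rw [← hx] at h
    exact (sq_le_sq₀ (by positivity) (by linarith)).1 h
  have hpos : 0 < diophantineZ α N β := by
    refine lt_of_lt_of_le ?_ (le_diophantineZ (k := k - 2) (by linarith) (hT _) ?_)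
    · have := cohnA_pos (k - 2); positivity
    · obtain ⟨i, hi⟩ : ∃ i, k = i + 2 := by
        refine ⟨k - 2, (Nat.sub_add_cancel (Nat.le_sqrt.2 ?_)).symm⟩
        have : (2 * 2 : ℝ) ≤ N := by nlinarith
        exact_mod_cast this
      have := Nat.sqrt_le' N
      rw [← hk, hi] at this
      rw [hi, Nat.add_sub_cancel]
      nlinarith
  have hC := one_le_rowConst hβ
  have hA := cohnA_pos (k + 1)
  -- Stage k + 1 is not reached before time N, since N < (k + 1)².
  have h := Real.log_le_log hpos
    (diophantineZ_le hα hβ (hT (k + 1)) (by nlinarith : N ≤ (k + 1) ^ 2 + 3 * (k + 1) + j))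
  rw [Real.log_div (by positivity) (by positivity), Real.log_rpow (by positivity),
    Real.log_div (by positivity) two_ne_zero] at h
  have hx0 : 0 < x := by linarith
  have hl : Real.log x ≤ x := (Real.log_le_sub_one_of_pos hx0).trans (by linarith)
  have h1 : Real.log (N * rowConst β + 1) ≤ (rowConst β + 2) * x := by
    have e : (N * rowConst β + 1 : ℝ) ≤ (rowConst β + 1) * x ^ 2 := by rw [← hx]; nlinarith
    have h2 := Real.log_le_log (by positivity) e
    rw [Real.log_mul (by positivity) (by positivity), Real.log_pow] at h2
    have h3 := Real.log_le_sub_one_of_pos (by positivity : 0 < rowConst β + 1)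
    push_cast at h2
    nlinarith
  have hlog1 : Real.log (k + 1 : ℕ) ≤ Real.log x + 1 := by
    have h2 : Real.log (k + 1 : ℕ) ≤ Real.log (2 * x) :=
      Real.log_le_log (by positivity) (by push_cast; linarith)
    rw [Real.log_mul two_ne_zero hx0.ne'] at h2
    linarith [Real.log_two_lt_d9]
  have hlx : 0 ≤ Real.log x := Real.log_nonneg (by linarith)
  have h8 : Real.log 8 ≤ 3 := by
    rw [show (8 : ℝ) = 2 ^ 3 by norm_num, Real.log_pow]
    push_cast
    linarith [Real.log_two_lt_d9]
  have hfin : -Real.log (cohnA (k + 1)) ≤ x * Real.log x + 9 * x := by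
    have hk1 : ((k + 1 : ℕ) : ℝ) ≤ x + 1 := by push_cast; linarith
    calc _ ≤ _ := neg_log_cohnA_le (k + 1)
      _ ≤ (x + 1) * (Real.log x + 1) + (x + 1) * 3 := by gcongr
      _ ≤ _ := by nlinarith
  have hfin' : -(Real.log (cohnA (k + 1)) - Real.log 2) ≤ x * Real.log x + 10 * x := by
    linarith [Real.log_two_lt_d9]
  have := mul_le_mul_of_nonneg_left hfin' (by linarith : (0 : ℝ) ≤ β)
  linarith

theorem hasFreeEnergyLimitAbove_of_euclid {α : ℝ} (hα : 0 ≤ α) {j : ℕ} (hj : j ≤ 1)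
    (hT : ∀ k, euclidStep^[k ^ 2 + 3 * k + j] (1, α) = (cohnB k, cohnA k) ∨
      euclidStep^[k ^ 2 + 3 * k + j] (1, α) = (cohnA k, cohnB k)) :
    HasFreeEnergyLimitAbove α (fun N : ℕ => Real.sqrt (N : ℝ) * Real.log (N : ℝ)) 2 := by
  intro β hβ
  refine ⟨β / 2, ?_⟩
  have hsqrt : Tendsto (fun N : ℕ => Real.sqrt (N : ℝ)) atTop atTop :=
    Real.tendsto_sqrt_atTop.comp tendsto_natCast_atTop_atTop
  have hlog : Tendsto (fun N : ℕ => Real.log (Real.sqrt (N : ℝ))) atTop atTop :=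
    Real.tendsto_log_atTop.comp hsqrt
  have hl : Tendsto (fun N : ℕ => β / 2 - 3 * β / Real.log (Real.sqrt (N : ℝ))) atTop
      (𝓝 (β / 2)) := by
    simpa using tendsto_const_nhds.sub (hlog.const_div_atTop (3 * β))
  have hu : Tendsto (fun N : ℕ => β / 2 +
      (10 * β + rowConst β + 2) / 2 / Real.log (Real.sqrt (N : ℝ))) atTop (𝓝 (β / 2)) := by
    simpa using tendsto_const_nhds.add
      (hlog.const_div_atTop ((10 * β + rowConst β + 2) / 2))
  -- The bounds are in terms of √N log √N; this factor 2 turns β into β / 2.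
  have hlogN : ∀ N : ℕ, Real.log (N : ℝ) = 2 * Real.log (Real.sqrt (N : ℝ)) := fun N => by
    rw [Real.log_sqrt N.cast_nonneg]; ring
  refine tendsto_of_tendsto_of_tendsto_of_le_of_le' hl hu ?_ ?_
  all_goals
    filter_upwards [hsqrt.eventually_ge_atTop 6] with N hN
    have hx : Real.sqrt (N : ℝ) ^ 2 = N := Real.sq_sqrt N.cast_nonneg
    have hx0 : 0 < Real.sqrt (N : ℝ) := by linarith
    have hlx : 0 < Real.log (Real.sqrt (N : ℝ)) := Real.log_pos (by linarith)
    rw [hlogN]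
  · rw [le_div_iff₀ (by positivity)]
    refine le_trans (le_of_eq ?_) (le_log_diophantineZ hβ hj hT hx hN)
    field_simp
    ring
  · rw [div_le_iff₀ (by positivity)]
    refine (log_diophantineZ_le hα hβ hj hT hx hN).trans (le_of_eq ?_)
    field_simp

theorem cohn_zero : (cohnB 0, cohnA 0) = ((1 : ℝ), Real.exp 1 - 1) := by
  simp [cohnA, cohnB, expBeta_zero_zero, expBeta_one_zero]

end FareyEnergy

theorem mainTheorem7 :
    FareyEnergy.HasFreeEnergyLimitAbove (Real.exp 1)
        (fun N : ℕ => Real.sqrt (N : ℝ) * Real.log (N : ℝ)) 2 ∧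
      FareyEnergy.HasFreeEnergyLimitAbove (Real.exp 1 - 1)
        (fun N : ℕ => Real.sqrt (N : ℝ) * Real.log (N : ℝ)) 2 := by
  have he : (1 : ℝ) < Real.exp 1 := Real.one_lt_exp_iff.2 one_pos
  refine ⟨FareyEnergy.hasFreeEnergyLimitAbove_of_euclid (by linarith) le_rfl fun k => ?_,
    FareyEnergy.hasFreeEnergyLimitAbove_of_euclid (by linarith) zero_le_one fun k => ?_⟩
  · rw [Function.iterate_succ_apply, FareyEnergy.euclidStep_of_lt he, ← FareyEnergy.cohn_zero]
    exact FareyEnergy.euclidStep_iterate_cohn k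
  · rw [← FareyEnergy.cohn_zero]
    exact FareyEnergy.euclidStep_iterate_cohn k
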